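/- \textbf{Setting.} A \emph{binomial PID} is a principal ideal domain $K$ of characteristic $0$ in which, for all $x\in K$ and $n\in\mathbb N$, there is an element $\binom{x}{n}$ with $n!\binom{x}{n}=x(x-1)\cdots(x-n+1)$. A \emph{$K$-group} (P. Hall) is a nilpotent group $G$ of class $c$ with powers $g^{\alpha}$ ($g\in G$, $\alpha\in K$) such that $x^1=x$, $x^{\alpha+\beta}=x^{\alpha}x^{\beta}$, $x^{\alpha\beta}=(x^{\alpha})^{\beta}$, $y^{-1}x^{\alpha}y=(y^{-1}xy)^{\alpha}$ and $x_1^{\alpha}\cdots x_n^{\alpha}=\tau_1^{\alpha}\tau_2^{\binom{\alpha}{2}}\cdots\tau_c^{\binom{\alpha}{c}}$, where $\tau_i=\tau_i(x_1,\dots,x_n)$ are the Hall--Petresco words, defined by $x_1^{k}\cdots x_n^{k}=\tau_1^{k}\tau_2^{\binom{k}{2}}\cdots\tau_k^{\binom{k}{k}}$ for all integers $k\ge 1$. $K$-subgroups, finite generation and $K$-isomorphisms are understood with respect to these powers. Let $G$ be a finitely generated $K$-group. A \emph{base} of period $(e_1,\dots,e_n)$ of an abelian $K$-group $A$ is a tuple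 $(a_1,\dots,a_n)$ with $A=Ka_1\oplus\dots\oplus Ka_n$ and $\mathrm{Ann}(a_i)=Ke_i$; the period $\infty$ (zero annihilator) is written $e_i=0$. A \emph{pseudo-basis} $\bar u=(u_1,\dots,u_m)$ of $G$ of period $(e_1,\dots,e_m)$ is a concatenation $\bar v_1\cup\dots\cup\bar v_c$, for some central series $G=G_1\ge\dots\ge G_{c+1}=1$ of $K$-subgroups, where $\bar v_i$ is a tuple of elements of $G_i$ whose images form a base of $G_i/G_{i+1}$ with the corresponding period. It is equipped with a \emph{section} $(d_1,\dots,d_m)$: $d_i\colon K\to K$ chooses one element in each coset of $Ke_i$ and is constant on cosets. A \emph{quotient function} $r_i\colon K\to K$ is a function with $x=e_ir_i(x)+d_i(x)$ for all $x$ (unique if $e_i\neq 0$, arbitrary if $e_i=0$). The \emph{coordinates} of $g\in G$ are the elements $t_i(g)\in d_i(K)$ with $g=u_1^{t_1(g)}\cdots u_m^{t_m(g)}$. The \emph{structural constants} of $\bar u$ are the $t_k([u_i,u_j])$ and $t_k(u_i^{e_i})$, $1\le i,j,k\le m$, where $[x,y]=x^{-1}y^{-1}xy$ (so if $e_i=0$,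 then $u_i^{e_i}=1$). Let $\mathfrak F_m$ be the signature with unary symbols $R_i,D_i$ ($1\le i\le m$) and $B_n$ ($n\in\mathbb N$), the ring operations $+,\cdot,-$, constants $c_n$ ($n\in\mathbb N$), and one constant symbol for each (index of a) structural constant. A term over $\mathfrak F_m$ \emph{computes} a function with respect to $\bar u$ with its period and section if it evaluates to that function when $R_i,D_i,B_n,c_n$ are read as $r_i,d_i,x\mapsto\binom{x}{n},n$, whatever quotient functions $r_i$ are used, and the remaining constants as the structural constants of $\bar u$. \textbf{Theorem (Uniform Coordinatization).} For every natural number $m$ there are terms $M_1,\dots,M_m$ in $2m$ variables and $D_1,\dots,D_m$ in $m+1$ variables over $\mathfrak F_m$ such that for every binomial PID $K$, every finitely generated $K$-group $G$ and every pseudo-basis $\bar u$ of length $m$ of $G$, with any period and any section: \begin{enumerate} \item every $g\in G$ has exactly one tuple of coordinates; \item $M_k$ computes the function $(\alpha,\beta)\mapsto t_k(gh)$, where $g=u_1^{\alpha_1}\cdots u_m^{\alpha_m}$ and $h=u_1^{\beta_1}\cdots u_m^{\beta_m}$, for all $\alpha,\beta\in K^m$ and $1\le k\le m$; \item $D_k$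 computes the function $(\alpha,\lambda)\mapsto t_k(g^{\lambda})$, where $g=u_1^{\alpha_1}\cdots u_m^{\alpha_m}$, for all $\alpha\in K^m$, $\lambda\in K$ and $1\le k\le m$. \end{enumerate} \textbf{Corollary.} For every binomial PID $K$, two finitely generated $K$-groups $G$ and $H$ are $K$-isomorphic if and only if they have pseudo-bases of the same length with the same periods and the same structural constants (compared index by index; the sections may be different). -/

import Mathlib

universe u v w

/-- The Hall–Petresco words `τ_k(x₁, …, x_n)` evaluated at the entries of a list.  They are
determined recursively by
`x₁ ^ k ⋯ x_n ^ k = τ₁ ^ (k choose 1) * τ₂ ^ (k choose 2) * ⋯ * τ_k ^ (k choose k)`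
for all `k ≥ 1` (the word `τ₀` is trivial, so `τ₁ = x₁ ⋯ x_n`). -/
def hallWord {G : Type*} [Group G] (l : List G) (k : ℕ) : G :=
  ((List.ofFn fun i : Fin k => hallWord l i ^ (k.choose i)).prod)⁻¹ * (l.map (· ^ k)).prod
termination_by k
decreasing_by exact i.2

/-- `K`-groups in the sense of P. Hall: nilpotent groups with exponents in a binomial ring `K`.
`kpow g a` is the power `g ^ a`. -/
class KGroup (K : Type*) [CommRing K] [BinomialRing K] (G : Type*) [Group G] where
  nilpotent : Group.IsNilpotent G
  kpow : G → K → G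
  kpow_one : ∀ x : G, kpow x 1 = x
  kpow_add : ∀ (x : G) (a b : K), kpow x (a + b) = kpow x a * kpow x b
  kpow_mul : ∀ (x : G) (a b : K), kpow x (a * b) = kpow (kpow x a) b
  kpow_conj : ∀ (x y : G) (a : K), y⁻¹ * kpow x a * y = kpow (y⁻¹ * x * y) a
  /-- `x₁ ^ a ⋯ x_n ^ a = τ₁ ^ a * τ₂ ^ (a choose 2) * ⋯ * τ_c ^ (a choose c)`, where `c` is the
  nilpotency class of `G` (the factor with index `0` is trivial). -/
  kpow_hall : ∀ (l : List G) (a : K),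
    (l.map fun x => kpow x a).prod =
      ((List.range (Group.nilpotencyClass G + 1)).map
        fun i => kpow (hallWord l i) (Ring.choose a i)).prod

namespace KGroup

section

variable (K : Type*) [CommRing K] [BinomialRing K]

/-- A subgroup is a `K`-subgroup if it is closed under powers with exponents in `K`. -/
def IsKSubgroup {G : Type*} [Group G] [KGroup K G] (S : Subgroup G) : Prop :=
  ∀ (a : K), ∀ g ∈ S, kpow g a ∈ S

/-- `G` is finitely generated as a `K`-group: some finite subset lies in no proper
`K`-subgroup. -/
def FinGen (G : Type*) [Group G] [KGroup K G] : Prop :=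
  ∃ X : Finset G, ∀ S : Subgroup G, IsKSubgroup K S → (X : Set G) ⊆ S → S = ⊤

/-- `G` and `H` are isomorphic as `K`-groups. -/
def KIsomorphic (G H : Type*) [Group G] [KGroup K G] [Group H] [KGroup K H] : Prop :=
  ∃ f : G ≃* H, ∀ (g : G) (a : K), f (kpow g a) = kpow (f g) a

end

section

variable {K : Type*} [CommRing K] [BinomialRing K] {G : Type*} [Group G] [KGroup K G]

/-- The ordered product `u₁ ^ α₁ * ⋯ * u_m ^ α_m`. -/
def vecPow {m : ℕ} (u : Fin m → G) (α : Fin m → K) : G :=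
  ((List.finRange m).map fun j => kpow (u j) (α j)).prod

/-- The ordered product of the `u_j ^ α_j` over those `j` that satisfy `p`. -/
def blockPow {m : ℕ} (u : Fin m → G) (p : Fin m → Prop) [DecidablePred p] (α : Fin m → K) : G :=
  (((List.finRange m).filter fun j => p j).map fun j => kpow (u j) (α j)).prod

/-- `IsBaseMod A B u p e`: for `K`-subgroups `B ≤ A` with `A / B` abelian, the images of the
elements `u_j` with `p j` form a base of period `(e_j)` of the abelian `K`-group `A / B`: they lie
in `A / B`, generate it, the sum of the cyclic `K`-groups that they generate is direct, and `e_j`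
generates the annihilator of the image of `u_j`.  A period `∞` (that is, annihilator zero) is
written as `e_j = 0`. -/
structure IsBaseMod {m : ℕ} (A B : Subgroup G) (u : Fin m → G) (p : Fin m → Prop)
    [DecidablePred p] (e : Fin m → K) : Prop where
  mem : ∀ j, p j → u j ∈ A
  generates : ∀ g ∈ A, ∃ α : Fin m → K, (blockPow u p α)⁻¹ * g ∈ B
  direct : ∀ α : Fin m → K, blockPow u p α ∈ B → ∀ j, p j → kpow (u j) (α j) ∈ B
  period : ∀ j, p j → ∀ a : K, kpow (u j) a ∈ B ↔ a ∈ Ideal.span {e j}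

/-- `u` is a pseudo-basis of `G` of period `e`: there are a central series
`G = S 0 ≥ S 1 ≥ ⋯ ≥ S c = 1` of `K`-subgroups and a division of the tuple `u` into consecutive
blocks (the block of index `i` consists of the `u_j` with `lev j = i`) such that the block of
index `i` is a base of `S i / S (i + 1)`, with the corresponding part of `e` as its period. -/
def IsPseudoBasis {m : ℕ} (u : Fin m → G) (e : Fin m → K) : Prop :=
  ∃ (c : ℕ) (S : ℕ → Subgroup G) (lev : Fin m → Fin c),
    S 0 = ⊤ ∧ S c = ⊥ ∧
    (∀ i < c, S (i + 1) ≤ S i) ∧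
    (∀ i ≤ c, IsKSubgroup K (S i)) ∧
    (∀ i < c, ∀ g ∈ S i, ∀ h : G, g⁻¹ * h⁻¹ * g * h ∈ S (i + 1)) ∧
    Monotone lev ∧
    ∀ i < c, IsBaseMod (S i) (S (i + 1)) u (fun j => (lev j : ℕ) = i) e

end

/-- A pseudo-basis of length `m` of a `K`-group, with a period and a section of it. -/
structure PseudoBasis (K : Type*) [CommRing K] [BinomialRing K]
    (G : Type*) [Group G] [KGroup K G] (m : ℕ) where
  u : Fin m → G
  /-- The period; `e i = 0` stands for the period `∞`. -/
  e : Fin m → K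
  /-- The section: `d i` picks one element in each coset of the ideal generated by `e i`. -/
  d : Fin m → K → K
  isPseudoBasis : IsPseudoBasis u e
  d_mem : ∀ (i : Fin m) (x : K), d i x - x ∈ Ideal.span {e i}
  d_const : ∀ (i : Fin m) (x y : K), x - y ∈ Ideal.span {e i} → d i x = d i y

namespace PseudoBasis

variable {K : Type*} [CommRing K] [BinomialRing K] {G : Type*} [Group G] [KGroup K G] {m : ℕ}

/-- `t` is a tuple of coordinates of `g`: each `t_i` is a value of the section `d_i` and
`g = u₁ ^ t₁ * ⋯ * u_m ^ t_m`. -/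
def IsCoord (B : PseudoBasis K G m) (g : G) (t : Fin m → K) : Prop :=
  (∀ i, t i ∈ Set.range (B.d i)) ∧ g = vecPow B.u t

/-- The coordinates `t₁(g), …, t_m(g)` of `g`: the tuple `t` with `B.IsCoord g t`. -/
noncomputable def coord (B : PseudoBasis K G m) (g : G) : Fin m → K :=
  Classical.epsilon (B.IsCoord g)

/-- The structural constant `t_k([u_i, u_j])`, where `[x, y] = x⁻¹ y⁻¹ x y`. -/
noncomputable def commConst (B : PseudoBasis K G m) (i j k : Fin m) : K :=
  B.coord ((B.u i)⁻¹ * (B.u j)⁻¹ * B.u i * B.u j) k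

/-- The structural constant `t_k(u_i ^ e_i)`.  If `u_i` has period `∞`, then `e_i = 0`, and this is
the coordinate `t_k(1)` of the identity. -/
noncomputable def powConst (B : PseudoBasis K G m) (i k : Fin m) : K :=
  B.coord (kpow (B.u i) (B.e i)) k

/-- `r` is a tuple of quotient functions: `x = e_i r_i(x) + d_i(x)`.  If `e_i ≠ 0`, this determines
`r_i` in a domain; if `u_i` has period `∞`, then `d_i(x) = x`, and `r_i` may be any function. -/
def IsQuotient (B : PseudoBasis K G m) (r : Fin m → K → K) : Prop :=
  ∀ (i : Fin m) (x : K), x = B.e i * r i x + B.d i x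

end PseudoBasis

/-- Terms, with variables from `V`, over the signature of pseudo-bases of length `m`: unary symbols
`R_i`, `D_i` (`i < m`) and `B_n` (`n : ℕ`), the ring operations `+`, `·`, `-`, constants `c_n`
(`n : ℕ`), and one constant for each structural constant. -/
inductive Term (m : ℕ) (V : Type) : Type
  | var (v : V)
  | quot (i : Fin m) (s : Term m V)
  | sect (i : Fin m) (s : Term m V)
  | binom (n : ℕ) (s : Term m V)
  | add (s t : Term m V)
  | mul (s t : Term m V)
  | neg (s : Term m V)
  | nat (n : ℕ)
  | comm (i j k : Fin m)
  | power (i k : Fin m)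

namespace Term

variable {m : ℕ} {V : Type} {K : Type*} [CommRing K] [BinomialRing K]
  {G : Type*} [Group G] [KGroup K G]

/-- The value of a term with respect to a pseudo-basis, with quotient functions `r`. -/
noncomputable def eval (B : PseudoBasis K G m) (r : Fin m → K → K) (x : V → K) : Term m V → K
  | var v => x v
  | quot i s => r i (eval B r x s)
  | sect i s => B.d i (eval B r x s)
  | binom n s => Ring.choose (eval B r x s) n
  | add s t => eval B r x s + eval B r x t
  | mul s t => eval B r x s * eval B r x t
  | neg s => - eval B r x s
  | nat n => (n : K)
  | comm i j k => B.commConst i j k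
  | power i k => B.powConst i k

/-- The term `s` computes the function `f` with respect to the pseudo-basis `B`. -/
def Computes (s : Term m V) (B : PseudoBasis K G m) (f : (V → K) → K) : Prop :=
  ∀ r : Fin m → K → K, B.IsQuotient r → ∀ x : V → K, s.eval B r x = f x

end Term

end KGroup

/-! Take all pseudo-bases of length `m`, over all `K` and `G`, together with quotient functions and
values of the variables, as indices `ω` of one product group with exponents in the product ring. The
functions of `ω` given by terms form a subring `C`, closed under binomial coefficients. It suffices
that the products of the `u_j ^ α_j` with all `α_j ∈ C` form a subgroup closed under powers from
`C`, and that the coordinates of its elements lie in `C`. Uniformity is then automatic, and no term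
is written out beyond single symbols.

The subgroup is built from the end of the tuple (`Env.exists_subgroup`). Let `L` belong to the
entries after `u_j`, and consider the elements `u_j ^ a * h` with `a ∈ C`, `h ∈ L`. By the
Hall–Petresco law `(s ^ a * h) ^ c` lies in `s ^ (a * c) * L`, because the words `τ_i(x, h)` with `i
≥ 2` become trivial when `h` does (`Normalises.pw_mul_mem`). This gives closure under powers and,
once `[u_s, u_j] ∈ L`, normalisation. The commutators and `u_j ^ e_j` do lie in `L`, since their
coordinates are structural constants. Finally `u_j ^ a = u_j ^ d_j(a) * (u_j ^ e_j) ^ r_j(a)` turns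
exponents into coordinates. A single Hall–Petresco formula serves the whole product because a
pseudo-basis of length `m` bounds the class by `m`.

For the corollary, equal periods and constants allow equal sections, hence equal multiplication and
powers on the same set of coordinate tuples. Conversely, a pseudo-basis is transported along the
isomorphism; one exists because iterated commutators of the generators can be adjoined, highest
weight first. -/

/-! ### Hall–Petresco words -/

theorem hallWord_eq {G : Type*} [Group G] (l : List G) (k : ℕ) :
    hallWord l k =
      (((List.range k).map fun i => hallWord l i ^ (k.choose i)).prod)⁻¹ *
        (l.map (· ^ k)).prod := by
  rw [hallWord, List.ofFn_eq_map, ← List.map_coe_finRange_eq_range, List.map_map]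
  rfl

theorem map_hallWord {G H : Type*} [Group G] [Group H] (f : G →* H) (l : List G) (k : ℕ) :
    f (hallWord l k) = hallWord (l.map f) k := by
  induction k using Nat.strong_induction_on with
  | _ k ih =>
    rw [hallWord_eq, hallWord_eq, map_mul, map_inv, map_list_prod, map_list_prod, List.map_map,
      List.map_map, List.map_map]
    congr 3
    · refine List.map_congr_left fun i hi => ?_
      simp [ih i (List.mem_range.1 hi)]
    · ext x
      simp

theorem hallWord_zero {G : Type*} [Group G] (l : List G) : hallWord l 0 = 1 := by
  rw [hallWord_eq]; simp

theorem hallWord_one {G : Type*} [Group G] (l : List G) : hallWord l 1 = l.prod := by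
  rw [hallWord_eq]; simp [hallWord_zero]

/-- Since `τ₁ = x`, the factor `τ₁ ^ k` already accounts for `x ^ k * 1 ^ k`, and the recursion
leaves nothing for later words. -/
theorem hallWord_pair_one {G : Type*} [Group G] (x : G) (k : ℕ) :
    hallWord [x, 1] (k + 2) = 1 := by
  induction k using Nat.strong_induction_on with
  | _ k ih =>
    have h : (((List.range k).map Nat.succ).map Nat.succ).map
        (fun i => hallWord [x, 1] i ^ ((k + 2).choose i)) = (List.range k).map fun _ => (1 : G) := by
      rw [List.map_map, List.map_map]
      refine List.map_congr_left fun i hi => ?_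
      simp [ih i (List.mem_range.1 hi)]
    rw [hallWord_eq, List.range_succ_eq_map, List.range_succ_eq_map]
    simp only [List.map_cons] at h ⊢
    rw [h]
    simp [hallWord_zero, hallWord_one]

/-- Inside the normaliser of `L`, pass to the quotient by `L`: there `h` becomes `1`, and the words
of index at least `2` vanish. -/
theorem hallWord_pair_mem {G : Type*} [Group G] {L : Subgroup G} {x h : G}
    (hx : x ∈ Subgroup.normalizer (L : Set G)) (hh : h ∈ L) (k : ℕ) :
    hallWord [x, h] (k + 2) ∈ L := by
  let N := Subgroup.normalizer (L : Set G)
  have hLN : L ≤ N := Subgroup.le_normalizer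
  let x' : N := ⟨x, hx⟩
  let h' : N := ⟨h, hLN hh⟩
  let L' : Subgroup N := L.subgroupOf N
  have : L'.Normal := Subgroup.normal_in_normalizer
  have h1 : hallWord [x, h] (k + 2) = N.subtype (hallWord [x', h'] (k + 2)) := by
    rw [map_hallWord]; rfl
  have h2 : QuotientGroup.mk' L' h' = 1 := (QuotientGroup.eq_one_iff _).2 hh
  have h3 : QuotientGroup.mk' L' (hallWord [x', h'] (k + 2)) = 1 := by
    rw [map_hallWord]
    simp only [List.map_cons, List.map_nil, h2]
    exact hallWord_pair_one _ _
  rw [h1]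
  exact Subgroup.mem_subgroupOf.1 ((QuotientGroup.eq_one_iff (N := L') _).1 h3)

/-! ### Hall powers with exponents in a subring -/

/-- Powers of the elements of a group `Γ` with exponents in a ring `R` that satisfy P. Hall's laws,
with the Hall–Petresco words of index at most `N + 1`. -/
structure HallPower (Γ R : Type*) [Group Γ] [CommRing R] (N : ℕ) where
  pw : Γ → R → Γ
  ch : R → ℕ → R
  ch_one : ∀ a, ch a 1 = a
  pw_one : ∀ x, pw x 1 = x
  pw_add : ∀ x a b, pw x (a + b) = pw x a * pw x b
  pw_mul : ∀ x a b, pw x (a * b) = pw (pw x a) b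
  pw_conj : ∀ x y a, y⁻¹ * pw x a * y = pw (y⁻¹ * x * y) a
  pw_hall : ∀ (l : List Γ) a, (l.map fun x => pw x a).prod =
    ((List.range (N + 2)).map fun i => pw (hallWord l i) (ch a i)).prod

namespace HallPower

variable {Γ R : Type*} [Group Γ] [CommRing R] {N : ℕ} (H : HallPower Γ R N)

theorem pw_zero (x : Γ) : H.pw x 0 = 1 := by
  have := H.pw_add x 0 0
  rwa [add_zero, left_eq_mul] at this

theorem one_pw (a : R) : H.pw 1 a = 1 := by
  rw [← H.pw_zero 1, ← H.pw_mul, zero_mul]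

theorem pw_neg (x : Γ) (a : R) : H.pw x (-a) = (H.pw x a)⁻¹ := by
  rw [eq_inv_iff_mul_eq_one, ← H.pw_add, neg_add_cancel, pw_zero]

/-- `L` is closed under powers with exponents in `C`. -/
def Closed (C : Subring R) (L : Subgroup Γ) : Prop := ∀ a ∈ C, ∀ g ∈ L, H.pw g a ∈ L

/-- The powers of `s` with exponents in `C` normalise `L`. -/
def Normalises (C : Subring R) (s : Γ) (L : Subgroup Γ) : Prop :=
  ∀ b ∈ C, ∀ h ∈ L, (H.pw s b)⁻¹ * h * H.pw s b ∈ L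

variable {H} {C : Subring R} {L : Subgroup Γ} {s j : Γ}

theorem Normalises.mem_normalizer (hs : H.Normalises C s L) {b : R} (hb : b ∈ C) :
    H.pw s b ∈ Subgroup.normalizer (L : Set Γ) := by
  rw [Subgroup.mem_normalizer_iff'']
  refine fun h => ⟨hs b hb h, fun hh => ?_⟩
  have := hs (-b) (neg_mem hb) _ hh
  rw [H.pw_neg] at this
  simpa [mul_assoc] using this

/-- The Hall–Petresco law for the pair `s ^ a, h` reads `s ^ (a * c) * h ^ c = (s ^ a * h) ^ c * w`,
where `w` collects the words of index at least `2` and so lies in `L`. -/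
theorem Normalises.pw_mul_mem (hs : H.Normalises C s L) (hL : H.Closed C L)
    (hC : ∀ a ∈ C, ∀ i, H.ch a i ∈ C) {a c : R} (ha : a ∈ C) (hc : c ∈ C) {h : Γ} (hh : h ∈ L) :
    (H.pw s (a * c))⁻¹ * H.pw (H.pw s a * h) c ∈ L := by
  have key := H.pw_hall [H.pw s a, h] c
  have hmem : (((List.range N).map fun i =>
      H.pw (hallWord [H.pw s a, h] (i + 2)) (H.ch c (i + 2))).prod) ∈ L := by
    refine list_prod_mem fun y hy => ?_
    obtain ⟨i, -, rfl⟩ := List.mem_map.1 hy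
    exact hL _ (hC c hc _) _ (hallWord_pair_mem (hs.mem_normalizer ha) hh i)
  have hmap : (((List.range N).map Nat.succ).map Nat.succ).map
      (fun i => H.pw (hallWord [H.pw s a, h] i) (H.ch c i)) = (List.range N).map
        fun i => H.pw (hallWord [H.pw s a, h] (i + 2)) (H.ch c (i + 2)) := by
    rw [List.map_map, List.map_map]; rfl
  rw [List.range_succ_eq_map, List.range_succ_eq_map] at key
  simp only [List.map_cons] at key hmap
  rw [hmap] at key
  simp only [hallWord_zero, H.one_pw, List.prod_cons, hallWord_one, H.ch_one,
    List.map_nil, List.prod_nil, mul_one, one_mul, zero_add, Nat.succ_eq_add_one] at key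
  have h1 : (H.pw s (a * c))⁻¹ * H.pw (H.pw s a * h) c = H.pw h c * (((List.range N).map fun i =>
      H.pw (hallWord [H.pw s a, h] (i + 2)) (H.ch c (i + 2))).prod)⁻¹ := by
    rw [eq_mul_inv_iff_mul_eq, mul_assoc, ← key, H.pw_mul, inv_mul_cancel_left]
  rw [h1]
  exact mul_mem (hL c hc h hh) (inv_mem hmem)

/-- The subgroup of the elements `s ^ a * h` with `a ∈ C`, `h ∈ L`. -/
def adjoin (H : HallPower Γ R N) (C : Subring R) (s : Γ) (L : Subgroup Γ)
    (hs : H.Normalises C s L) : Subgroup Γ where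
  carrier := {g | ∃ a ∈ C, ∃ h ∈ L, g = H.pw s a * h}
  one_mem' := ⟨0, zero_mem C, 1, one_mem L, by rw [H.pw_zero, one_mul]⟩
  mul_mem' := by
    rintro _ _ ⟨a, ha, h, hh, rfl⟩ ⟨b, hb, k, hk, rfl⟩
    refine ⟨a + b, add_mem ha hb, _, mul_mem (hs b hb h hh) hk, ?_⟩
    rw [H.pw_add]; group
  inv_mem' := by
    rintro _ ⟨a, ha, h, hh, rfl⟩
    refine ⟨-a, neg_mem ha, _, hs (-a) (neg_mem ha) _ (inv_mem hh), ?_⟩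
    rw [H.pw_neg]; group

theorem le_adjoin (hs : H.Normalises C s L) : L ≤ H.adjoin C s L hs := fun h hh =>
  ⟨0, zero_mem C, h, hh, by rw [H.pw_zero, one_mul]⟩

theorem closed_adjoin (hs : H.Normalises C s L) (hL : H.Closed C L)
    (hC : ∀ a ∈ C, ∀ i, H.ch a i ∈ C) : H.Closed C (H.adjoin C s L hs) := by
  rintro c hc _ ⟨a, ha, h, hh, rfl⟩
  exact ⟨a * c, mul_mem ha hc, _, hs.pw_mul_mem hL hC ha hc hh, by group⟩

/-- If `[s, j] ∈ L` and the powers of `s` and `j` normalise `L`, then the powers of `s` normalise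
the subgroup generated by `L` and the powers of `j`. -/
theorem Normalises.adjoin (hs : H.Normalises C s L) (hj : H.Normalises C j L) (hL : H.Closed C L)
    (hC : ∀ a ∈ C, ∀ i, H.ch a i ∈ C) (hsj : s⁻¹ * j⁻¹ * s * j ∈ L) :
    H.Normalises C s (H.adjoin C j L hj) := by
  have hcl := closed_adjoin hj hL hC
  rintro b hb _ ⟨a, ha, h, hh, rfl⟩
  have h1 : (H.pw s b)⁻¹ * j * H.pw s b ∈ H.adjoin C j L hj := by
    -- Conjugating by `j` replaces `s` by `s * [s, j]`, so the preceding congruence applies and `[s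
    -- ^ b, j]` need not be expanded.
    have e1 : j⁻¹ * (H.pw s b)⁻¹ * j = H.pw (s * (s⁻¹ * j⁻¹ * s * j)) (-b) := by
      rw [← H.pw_neg, H.pw_conj]; congr 1; group
    have e2 := hs.pw_mul_mem hL hC (one_mem C) (neg_mem hb) hsj
    rw [H.pw_one, one_mul, ← e1] at e2
    have e3 := hs b hb _ e2
    refine ⟨1, one_mem C, _, e3, ?_⟩
    rw [H.pw_one, H.pw_neg]; group
  have h2 := mul_mem (hcl a ha _ h1) (le_adjoin hj (hs b hb h hh))
  rw [← H.pw_conj] at h2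
  convert h2 using 1
  group

end HallPower

/-! ### Sections, normal `K`-subgroups and central series with cyclic factors -/

namespace KGroup

/-- The functions `d j` pick one element in each coset of the ideal generated by `e j`. -/
structure IsSection {ι K : Type*} [CommRing K] (e : ι → K) (d : ι → K → K) : Prop where
  mem : ∀ i x, d i x - x ∈ Ideal.span {e i}
  const : ∀ i x y, x - y ∈ Ideal.span {e i} → d i x = d i y

theorem IsSection.eq_of_mem {ι K : Type*} [CommRing K] {e : ι → K} {d : ι → K → K}
    (hd : IsSection e d) {i : ι} {x y : K}
    (hx : x ∈ Set.range (d i)) (hy : y ∈ Set.range (d i)) (h : x - y ∈ Ideal.span {e i}) :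
    x = y := by
  obtain ⟨x, rfl⟩ := hx
  obtain ⟨y, rfl⟩ := hy
  rw [← hd.const i _ _ (hd.mem i x), ← hd.const i _ _ (hd.mem i y)]
  exact hd.const i _ _ h

section

variable {K : Type*} [CommRing K] [BinomialRing K] {G : Type*} [Group G] [KGroup K G]

theorem kpow_zero (x : G) : kpow x (0 : K) = 1 := by
  have := kpow_add x (0 : K) 0
  rwa [add_zero, left_eq_mul] at this

theorem kpow_natCast (x : G) (n : ℕ) : kpow x (n : K) = x ^ n := by
  induction n with
  | zero => rw [Nat.cast_zero, kpow_zero, pow_zero]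
  | succ n ih => rw [Nat.cast_succ, kpow_add, ih, kpow_one, pow_succ]

/-- For the exponent `k`, the axiom `kpow_hall` stops at the class while the recursion runs up to
`k`; by induction the intermediate words are trivial, so `τ_k` is too. This allows the law to be
padded to any larger length. -/
theorem hallWord_eq_one (K : Type*) [CommRing K] [BinomialRing K] {G : Type*} [Group G]
    [KGroup K G] (l : List G) (k : ℕ) (hk : Group.nilpotencyClass G < k) :
    hallWord l k = 1 := by
  induction k using Nat.strong_induction_on with
  | _ k ih =>
    have h := kpow_hall l (k : K)
    obtain ⟨d, rfl⟩ := Nat.exists_eq_add_of_lt hk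
    simp only [kpow_natCast, Ring.choose_natCast] at h
    rw [hallWord_eq, h, inv_mul_eq_one, show Group.nilpotencyClass G + d + 1 =
      Group.nilpotencyClass G + 1 + d by ring, List.range_add, List.map_append, List.prod_append]
    convert mul_one _
    refine List.prod_eq_one fun y hy => ?_
    simp only [List.map_map, List.mem_map, List.mem_range, Function.comp_apply] at hy
    obtain ⟨i, hi, rfl⟩ := hy
    rw [ih _ (by omega) (by omega), one_pow]

variable (K G) in
/-- The powers of a `K`-group of class at most `N + 1`. -/
noncomputable def hallPower (N : ℕ) (hN : Group.nilpotencyClass G ≤ N + 1) :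
    HallPower G K N where
  pw := kpow
  ch := Ring.choose
  ch_one := Ring.choose_one_right
  pw_one := kpow_one
  pw_add := kpow_add
  pw_mul := kpow_mul
  pw_conj := kpow_conj
  pw_hall l a := by
    have one_kpow : ∀ b : K, kpow (1 : G) b = 1 := fun b => by
      rw [← kpow_zero (K := K) (1 : G), ← kpow_mul, zero_mul]
    obtain ⟨d, hd⟩ := Nat.exists_eq_add_of_le hN
    rw [kpow_hall, show N + 2 = Group.nilpotencyClass G + 1 + d by omega,
      List.range_add (n := Group.nilpotencyClass G + 1), List.map_append, List.prod_append]
    refine (mul_eq_left.2 ?_).symm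
    refine List.prod_eq_one fun y hy => ?_
    simp only [List.map_map, List.mem_map, List.mem_range, Function.comp_apply] at hy
    obtain ⟨i, hi, rfl⟩ := hy
    rw [hallWord_eq_one K _ _ (by omega), one_kpow]

variable (K G) in
/-- The powers of a `K`-group as a `HallPower`. -/
noncomputable abbrev stdPower : HallPower G K (Group.nilpotencyClass G) :=
  hallPower K G _ (Nat.le_succ _)

theorem kpow_neg (x : G) (a : K) : kpow x (-a) = (kpow x a)⁻¹ := (stdPower K G).pw_neg x a

theorem kpow_neg_add (x : G) (a b : K) : kpow x (-a + b) = (kpow x a)⁻¹ * kpow x b := by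
  rw [kpow_add, kpow_neg]

theorem one_kpow (a : K) : kpow (1 : G) a = 1 := (stdPower K G).one_pw a

/-- A `K`-subgroup that contains all commutators of its elements with elements of `G`. -/
structure NormalK (K : Type*) [CommRing K] [BinomialRing K] {G : Type*} [Group G] [KGroup K G]
    (S : Subgroup G) : Prop where
  kpow_mem : IsKSubgroup K S
  comm_mem : ∀ g ∈ S, ∀ h : G, g⁻¹ * h⁻¹ * g * h ∈ S

theorem NormalK.conj_mem {S : Subgroup G} (hS : NormalK K S) {g : G} (hg : g ∈ S) (h : G) :
    h⁻¹ * g * h ∈ S := by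
  have := mul_mem hg (hS.comm_mem g hg h)
  convert this using 1
  group

theorem NormalK.normalises {S : Subgroup G} (hS : NormalK K S) (s : G) :
    (stdPower K G).Normalises ⊤ s S := fun _ _ _ hh => hS.conj_mem hh _

theorem NormalK.closed {S : Subgroup G} (hS : NormalK K S) :
    (stdPower K G).Closed ⊤ S := fun a _ g hg => hS.kpow_mem a g hg

/-- Powers respect congruence modulo a normal `K`-subgroup. -/
theorem NormalK.kpow_congr {S : Subgroup G} (hS : NormalK K S) (s : G) {h : G} (hh : h ∈ S)
    (a : K) : (kpow s a)⁻¹ * kpow (s * h) a ∈ S := by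
  have := (hS.normalises s).pw_mul_mem hS.closed (fun _ _ _ => trivial) (a := 1) (c := a)
    trivial trivial hh
  rwa [one_mul, HallPower.pw_one] at this

/-- Conjugation by `g` turns `y` into `y * [y, g]`, and powers respect congruence modulo `S`. -/
theorem NormalK.comm_kpow_mem {S : Subgroup G} (hS : NormalK K S) {y g : G}
    (h : y⁻¹ * g⁻¹ * y * g ∈ S) (a : K) : (kpow y a)⁻¹ * g⁻¹ * kpow y a * g ∈ S := by
  have h1 := hS.kpow_congr y h a
  have e : y * (y⁻¹ * g⁻¹ * y * g) = g⁻¹ * y * g := by group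
  rw [e, ← kpow_conj] at h1
  simpa [mul_assoc] using h1

theorem comm_mem_swap {S : Subgroup G} {y g : G} (h : y⁻¹ * g⁻¹ * y * g ∈ S) :
    g⁻¹ * y⁻¹ * g * y ∈ S := by
  have := inv_mem h
  convert this using 1
  group

/-- The ordered product of the `u_j ^ α_j` over the entries `j` of a list. -/
def listPow {ι : Type*} (u : ι → G) (q : List ι) (α : ι → K) : G :=
  (q.map fun j => kpow (u j) (α j)).prod

theorem listPow_nil {ι : Type*} (u : ι → G) (α : ι → K) : listPow u [] α = 1 := rfl

theorem listPow_cons {ι : Type*} (u : ι → G) (j : ι) (q : List ι) (α : ι → K) :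
    listPow u (j :: q) α = kpow (u j) (α j) * listPow u q α := by
  simp [listPow]

theorem listPow_append {ι : Type*} (u : ι → G) (p q : List ι) (α : ι → K) :
    listPow u (p ++ q) α = listPow u p α * listPow u q α := by
  simp [listPow]

theorem listPow_congr {ι : Type*} (u : ι → G) (q : List ι) {α β : ι → K}
    (h : ∀ j ∈ q, α j = β j) : listPow u q α = listPow u q β := by
  unfold listPow
  congr 1
  exact List.map_congr_left fun j hj => by rw [h j hj]

/-- `Chain u e S q`: the elements `u_j`, for the entries `j` of `q`, define a central series of
`K`-subgroups from `S` down to `1` with cyclic factors, and `e_j` generates the annihilator of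
the factor generated by `u_j`. -/
inductive Chain {ι : Type*} (u : ι → G) (e : ι → K) : Subgroup G → List ι → Prop
  | nil : Chain u e ⊥ []
  | cons {S S' : Subgroup G} {j : ι} {q : List ι} (tail : Chain u e S' q)
      (kpow_mem : IsKSubgroup K S) (comm_mem : ∀ g ∈ S, ∀ h : G, g⁻¹ * h⁻¹ * g * h ∈ S')
      (mem_iff : ∀ g, g ∈ S ↔ ∃ a : K, ∃ h ∈ S', g = kpow (u j) a * h)
      (period : ∀ a : K, kpow (u j) a ∈ S' ↔ a ∈ Ideal.span {e j}) : Chain u e S (j :: q)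

namespace Chain

variable {ι : Type*} {u : ι → G} {e : ι → K} {S : Subgroup G} {q : List ι}

theorem normalK (hc : Chain u e S q) : NormalK K S := by
  cases hc with
  | nil =>
    refine ⟨fun a g hg => ?_, fun g hg h => ?_⟩
    · rw [Subgroup.mem_bot.1 hg, one_kpow]; exact one_mem _
    · rw [Subgroup.mem_bot.1 hg, inv_one, one_mul, mul_one, inv_mul_cancel]; exact one_mem _
  | cons tail h1 h2 h3 h4 =>
    exact ⟨h1, fun g hg h => (h3 _).2 ⟨0, _, h2 g hg h, by rw [kpow_zero, one_mul]⟩⟩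

theorem mem_nil (hc : Chain u e S []) : S = ⊥ := by
  cases hc; rfl

theorem extend {S' : Subgroup G} (hc : Chain u e S' q) (j : ι)
    (hj : ∀ h : G, (u j)⁻¹ * h⁻¹ * u j * h ∈ S')
    (he : ∀ a : K, kpow (u j) a ∈ S' ↔ a ∈ Ideal.span {e j}) :
    ∃ S, Chain u e S (j :: q) ∧ ∀ g, g ∈ S ↔ ∃ a : K, ∃ h ∈ S', g = kpow (u j) a * h := by
  have hn := hc.normalK
  have hs := hn.normalises (u j)
  refine ⟨(stdPower K G).adjoin ⊤ (u j) S' hs, ?_, ?_⟩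
  · refine .cons hc (fun a g hg => HallPower.closed_adjoin hs hn.closed (fun _ _ _ => trivial) a
      trivial g hg) ?_ ?_ he
    · rintro _ ⟨a, -, h, hh, rfl⟩ g
      have h1 := hn.comm_kpow_mem (hj g) a
      have h2 := mul_mem (hn.conj_mem h1 h) (hn.comm_mem h hh g)
      convert h2 using 1
      show (kpow (u j) a * h)⁻¹ * g⁻¹ * (kpow (u j) a * h) * g = _
      group
    · exact fun g => ⟨fun ⟨a, _, h⟩ => ⟨a, h⟩, fun ⟨a, h⟩ => ⟨a, trivial, h⟩⟩
  · exact fun g => ⟨fun ⟨a, _, h⟩ => ⟨a, h⟩, fun ⟨a, h⟩ => ⟨a, trivial, h⟩⟩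

theorem lowerCentralSeries_eq_bot (hc : Chain u e S q) (k : ℕ)
    (hk : Subgroup.lowerCentralSeries (⊤ : Subgroup G) k ≤ S) :
    Subgroup.lowerCentralSeries (⊤ : Subgroup G) (k + q.length) = ⊥ := by
  induction hc generalizing k with
  | nil => exact le_bot_iff.1 hk
  | @cons S S' j q tail h1 h2 h3 h4 ih =>
    have := ih (k + 1) ?_
    · rw [← this]; congr 1; simp; ring
    · rw [Subgroup.lowerCentralSeries_succ, Subgroup.commutator_le]
      intro g hg h _
      have h5 := h2 g⁻¹ (inv_mem (hk hg)) h⁻¹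
      rw [commutatorElement_def]
      simpa using h5

/-- The bound depends only on the length of the chain, which makes one Hall–Petresco formula valid
in all groups with a pseudo-basis of given length. -/
theorem nilpotencyClass_le (hc : Chain u e ⊤ q) : Group.nilpotencyClass G ≤ q.length := by
  have : Group.IsNilpotent G := KGroup.nilpotent K
  rw [← Subgroup.lowerCentralSeries_eq_bot_iff_nilpotencyClass_le]
  simpa using hc.lowerCentralSeries_eq_bot 0 le_top

/-- Replace the leading exponent `a` by `d j a`; the difference is a multiple of the period, so the
surplus power passes to the next subgroup. -/
theorem exists_coord [DecidableEq ι] {d : ι → K → K} (hd : IsSection e d) (hc : Chain u e S q)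
    (hq : q.Nodup) {g : G} (hg : g ∈ S) :
    ∃ t : ι → K, (∀ i, t i ∈ Set.range (d i)) ∧ g = listPow u q t := by
  induction hc generalizing g with
  | nil => exact ⟨fun i => d i 0, fun i => ⟨0, rfl⟩, Subgroup.mem_bot.1 hg⟩
  | @cons S S' j q tail h1 h2 h3 h4 ih =>
    obtain ⟨a, h, hh, rfl⟩ := (h3 g).1 hg
    rw [List.nodup_cons] at hq
    have h5 : kpow (u j) (-d j a + a) ∈ S' := by
      rw [h4, ← neg_mem_iff]
      convert hd.mem j a using 1
      ring
    obtain ⟨t, ht, he⟩ := ih hq.2 (mul_mem h5 hh)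
    refine ⟨Function.update t j (d j a), fun i => ?_, ?_⟩
    · by_cases hi : i = j
      · subst hi; simp
      · simpa [hi] using ht i
    · rw [listPow_cons, Function.update_self, listPow_congr (β := t), ← he, kpow_neg_add]
      · group
      · intro i hi
        rw [Function.update_of_ne]
        rintro rfl
        exact hq.1 hi

theorem listPow_mem (hc : Chain u e S q) (α : ι → K) : listPow u q α ∈ S := by
  induction hc with
  | nil => exact one_mem _
  | @cons S S' j q tail h1 h2 h3 h4 ih =>
    rw [listPow_cons, h3]
    exact ⟨_, _, ih, rfl⟩

/-- If `g` lies in the term of the series that belongs to the final segment `q` of `p ++ q`,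
multiplication by `g` from the right does not change the coordinates with index in `p`. -/
theorem listPow_mul_eq {d : ι → K → K} (hd : IsSection e d) {p : List ι}
    (hc : Chain u e S (p ++ q)) :
    ∃ S' ≤ S, Chain u e S' q ∧ ∀ o t : ι → K, (∀ i, o i ∈ Set.range (d i)) →
      (∀ i, t i ∈ Set.range (d i)) → ∀ g ∈ S', listPow u (p ++ q) o * g = listPow u (p ++ q) t →
      (∀ i ∈ p, o i = t i) ∧ listPow u q o * g = listPow u q t := by
  induction p generalizing S with
  | nil => exact ⟨S, le_rfl, hc, fun o t _ _ g _ h => ⟨by simp, h⟩⟩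
  | cons j p ih =>
    cases hc with
    | @cons _ S1 _ _ tail h1 h2 h3 h4 =>
      obtain ⟨S', hle, hc', ih'⟩ := ih tail
      have hle' : S1 ≤ S := fun g hg => (h3 g).2 ⟨0, g, hg, by rw [kpow_zero, one_mul]⟩
      refine ⟨S', hle.trans hle', hc', fun o t ho ht g hg h => ?_⟩
      rw [List.cons_append, listPow_cons, listPow_cons, mul_assoc] at h
      have h5 : kpow (u j) (-t j + o j) =
          listPow u (p ++ q) t * (listPow u (p ++ q) o * g)⁻¹ := by
        rw [kpow_neg_add, eq_mul_inv_iff_mul_eq, mul_assoc, h, inv_mul_cancel_left]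
      have h6 : kpow (u j) (-t j + o j) ∈ S1 := by
        rw [h5]
        exact mul_mem (tail.listPow_mem t) (inv_mem (mul_mem (tail.listPow_mem o) (hle hg)))
      -- Modulo `S1` only the leading powers remain, and two values of the section in one coset
      -- coincide.
      have h7 : o j = t j := by
        refine hd.eq_of_mem (ho j) (ht j) ?_
        rw [h4] at h6
        convert h6 using 1
        ring
      rw [h7, mul_right_inj] at h
      obtain ⟨h8, h9⟩ := ih' o t ho ht g hg h
      refine ⟨fun i hi => ?_, h9⟩
      rcases List.mem_cons.1 hi with rfl | hi
      exacts [h7, h8 i hi]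

end Chain

end

end KGroup

/-! ### From pseudo-bases to cyclic series; uniqueness of coordinates -/

namespace KGroup

section

variable {K : Type*} [CommRing K] [BinomialRing K] {G : Type*} [Group G] [KGroup K G]

theorem listPow_eq_one {ι : Type*} (u : ι → G) (q : List ι) {α : ι → K} (h : ∀ j ∈ q, α j = 0) :
    listPow u q α = 1 := by
  refine List.prod_eq_one fun y hy => ?_
  obtain ⟨j, hj, rfl⟩ := List.mem_map.1 hy
  rw [h j hj, kpow_zero]

/-- A direct sum of cyclic groups is refined to a cyclic series by adjoining the block's entries
from the last to the first; directness ensures that the periods do not shrink. -/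
theorem IsBaseMod.exists_chain {m : ℕ} {A B : Subgroup G} {u : Fin m → G} {p : Fin m → Prop}
    [DecidablePred p] {e : Fin m → K} (hb : IsBaseMod A B u p e)
    (hAB : ∀ g ∈ A, ∀ h : G, g⁻¹ * h⁻¹ * g * h ∈ B) {q₀ : List (Fin m)} (hc : Chain u e B q₀)
    (pre q : List (Fin m)) (hq : (List.finRange m).filter (fun j => p j) = pre ++ q) :
    ∃ T, Chain u e T (q ++ q₀) ∧ B ≤ T ∧
      ∀ g, g ∈ T ↔ ∃ α : Fin m → K, (listPow u q α)⁻¹ * g ∈ B := by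
  induction q generalizing pre with
  | nil =>
    refine ⟨B, hc, le_rfl, fun g => ⟨fun h => ⟨0, ?_⟩, fun ⟨α, h⟩ => ?_⟩⟩
    · rwa [listPow_nil, inv_one, one_mul]
    · rwa [listPow_nil, inv_one, one_mul] at h
  | cons j q ih =>
    obtain ⟨T', hT', hBT, hmem⟩ := ih (pre ++ [j]) (by rw [hq]; simp)
    have hnd : (pre ++ j :: q).Nodup := by
      rw [← hq]; exact (List.nodup_finRange m).filter _
    have hjq : j ∉ q := (List.nodup_cons.1 (List.nodup_append.1 hnd).2.1).1
    have hpq : ∀ i ∈ pre, i ∉ j :: q := fun i hi hi' =>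
      (List.nodup_append.1 hnd).2.2 i hi i hi' rfl
    have hpj : p j := by
      have : j ∈ (List.finRange m).filter (fun j => p j) := by rw [hq]; simp
      simpa using this
    obtain ⟨T, hT, hTm⟩ := hT'.extend j (fun h => hBT (hAB _ (hb.mem j hpj) h)) (fun a => by
      rw [← hb.period j hpj]
      refine ⟨fun h => ?_, fun h => hBT h⟩
      obtain ⟨α, hα⟩ := (hmem _).1 h
      -- If `u_j ^ a` is congruent to a product over the later entries, then `β` records this as a
      -- relation of the whole block modulo `B`, to which directness applies.
      let β : Fin m → K := fun i => if i ∈ q then α i else if i = j then -a else 0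
      have h1 : blockPow u p β ∈ B := by
        show listPow u ((List.finRange m).filter (fun j => p j)) β ∈ B
        rw [hq, listPow_append, listPow_cons, listPow_eq_one, one_mul,
          listPow_congr (β := α), show β j = -a by simp [β, hjq], kpow_neg]
        · have := inv_mem hα
          rwa [mul_inv_rev, inv_inv] at this
        · intro i hi; simp [β, hi]
        · intro i hi
          have := hpq i hi
          rw [List.mem_cons, not_or] at this
          simp [β, this.1, this.2]
      have h2 := hb.direct β h1 j hpj
      rw [show β j = -a by simp [β, hjq], kpow_neg] at h2
      exact inv_mem_iff.1 h2)
    refine ⟨T, hT, fun b hbB => (hTm b).2 ⟨0, b, hBT hbB, by rw [kpow_zero, one_mul]⟩,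
      fun g => ?_⟩
    rw [hTm]
    constructor
    · rintro ⟨a, h, hh, rfl⟩
      obtain ⟨α, hα⟩ := (hmem _).1 hh
      refine ⟨Function.update α j a, ?_⟩
      rw [listPow_cons, Function.update_self, listPow_congr (β := α)]
      · convert hα using 1; group
      · intro i hi
        rw [Function.update_of_ne]
        rintro rfl
        exact hjq hi
    · rintro ⟨α, hα⟩
      refine ⟨α j, (kpow (u j) (α j))⁻¹ * g, (hmem _).2 ⟨α, ?_⟩, by group⟩
      rw [listPow_cons] at hα
      convert hα using 1; group

theorem filter_le_eq_append {ι : Type*} (lev : ι → ℕ) (i : ℕ) (l : List ι)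
    (hl : l.Pairwise fun a b => lev a ≤ lev b) :
    l.filter (fun j => i ≤ lev j) =
      l.filter (fun j => lev j = i) ++ l.filter (fun j => i + 1 ≤ lev j) := by
  induction l with
  | nil => rfl
  | cons a l ih =>
    rw [List.pairwise_cons] at hl
    rcases lt_trichotomy (lev a) i with h | h | h
    · rw [List.filter_cons_of_neg (by simpa using h), List.filter_cons_of_neg (by simpa using h.ne),
        List.filter_cons_of_neg (by simp; omega), ih hl.2]
    · rw [List.filter_cons_of_pos (by simp [h]), List.filter_cons_of_pos (by simp [h]),
        List.filter_cons_of_neg (by simp; omega), ih hl.2, List.cons_append]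
    · rw [List.filter_cons_of_pos (by simp; omega), List.filter_cons_of_neg (by simp; omega),
        List.filter_cons_of_pos (by simp; omega), ih hl.2]
      have : l.filter (fun j => decide (lev j = i)) = [] := by
        rw [List.filter_eq_nil_iff]
        intro b hb
        have := hl.1 b hb
        simp; omega
      rw [this]
      rfl

theorem IsPseudoBasis.chain {m : ℕ} {u : Fin m → G} {e : Fin m → K} (h : IsPseudoBasis u e) :
    Chain u e ⊤ (List.finRange m) := by
  obtain ⟨c, S, lev, h0, hc, hle, hK, hcomm, hmono, hbase⟩ := h
  have key : ∀ k ≤ c, Chain u e (S (c - k))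
      ((List.finRange m).filter fun j => c - k ≤ (lev j : ℕ)) := by
    intro k
    induction k with
    | zero =>
      intro _
      rw [Nat.sub_zero, hc, List.filter_eq_nil_iff.2]
      · exact .nil
      · intro j _
        have := (lev j).2
        simp
    | succ k ih =>
      intro hk
      have hlt : c - (k + 1) < c := by omega
      have hs : c - (k + 1) + 1 = c - k := by omega
      have hb := hbase _ hlt
      have hcm := hcomm _ hlt
      rw [hs] at hb hcm
      obtain ⟨T, hT, hBT, hm⟩ := hb.exists_chain hcm (ih (by omega)) [] _ rfl
      have hTA : T = S (c - (k + 1)) := by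
        ext g
        rw [hm]
        refine ⟨fun ⟨α, hα⟩ => ?_, fun hg => hb.generates g hg⟩
        have h1 := hle _ hlt
        rw [hs] at h1
        have h2 : listPow u ((List.finRange m).filter
            fun j => ((lev j : ℕ) = c - (k + 1))) α ∈ S (c - (k + 1)) := by
          refine list_prod_mem fun y hy => ?_
          obtain ⟨j, hj, rfl⟩ := List.mem_map.1 hy
          exact hK _ hlt.le _ _ (hb.mem j (by simpa using hj))
        have := mul_mem h2 (h1 hα)
        rwa [mul_inv_cancel_left] at this
      rw [← hTA, filter_le_eq_append (fun j => (lev j : ℕ)), hs]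
      · exact hT
      · exact (List.pairwise_le_finRange m).imp fun h => hmono h
  have := key c le_rfl
  rw [Nat.sub_self, h0] at this
  simpa using this

namespace PseudoBasis

variable {m : ℕ} (B : PseudoBasis K G m)

theorem isSection : IsSection B.e B.d := ⟨B.d_mem, B.d_const⟩

theorem chain : Chain B.u B.e ⊤ (List.finRange m) := B.isPseudoBasis.chain

theorem existsUnique_isCoord (g : G) : ∃! t : Fin m → K, B.IsCoord g t := by
  obtain ⟨t, ht, hg⟩ := B.chain.exists_coord B.isSection (List.nodup_finRange m)
    (Subgroup.mem_top g)
  refine ⟨t, ⟨ht, hg⟩, fun t' ht' => funext fun i => ?_⟩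
  have hc := B.chain
  rw [← List.append_nil (List.finRange m)] at hc
  obtain ⟨S', -, -, h⟩ := hc.listPow_mul_eq B.isSection
  refine (h t' t ht'.1 ht 1 (one_mem _) ?_).1 i (List.mem_finRange i)
  rw [mul_one, List.append_nil]
  exact ht'.2.symm.trans hg

theorem isCoord_coord (g : G) : B.IsCoord g (B.coord g) :=
  Classical.epsilon_spec (B.existsUnique_isCoord g).exists

theorem coord_eq {g : G} {t : Fin m → K} (h : B.IsCoord g t) : B.coord g = t :=
  (B.existsUnique_isCoord g).unique (B.isCoord_coord g) h

end PseudoBasis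

end

end KGroup

/-! ### The product over all pseudo-bases, and the existence of terms -/

namespace KGroup

section

variable {K : Type*} [CommRing K] [BinomialRing K] {G : Type*} [Group G] [KGroup K G]

theorem Chain.unique {ι : Type*} {u : ι → G} {e : ι → K} {S T : Subgroup G} {q : List ι}
    (hS : Chain u e S q) (hT : Chain u e T q) : S = T := by
  induction hS generalizing T with
  | nil => exact hT.mem_nil.symm
  | cons tail _ _ h3 _ ih =>
    cases hT with
    | cons tail' _ _ h3' _ =>
      obtain rfl := ih tail'
      ext g
      rw [h3, h3']

/-- Elements of the term of the central series that starts with `q` are known from the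
coordinates with index in `q` of the element and of `1`. -/
theorem PseudoBasis.listPow_coord {m : ℕ} (B : PseudoBasis K G m) {p q : List (Fin m)} {j : Fin m}
    (hq : List.finRange m = p ++ j :: q) :
    ∃ S : Subgroup G, (∀ h : G, (B.u j)⁻¹ * h⁻¹ * B.u j * h ∈ S) ∧
      (∀ a : K, kpow (B.u j) (B.e j * a) ∈ S) ∧
      ∀ g ∈ S, listPow B.u q (B.coord 1) * g = listPow B.u q (B.coord g) := by
  have hc := B.chain
  rw [hq] at hc
  obtain ⟨S, -, hS, -⟩ := hc.listPow_mul_eq B.isSection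
  -- Counting `u_j` with the prefix yields the subgroup just below it, which contains its
  -- commutators and `u_j ^ e_j`.
  rw [show p ++ j :: q = (p ++ [j]) ++ q by simp] at hc hq
  obtain ⟨S', -, hS', h'⟩ := hc.listPow_mul_eq B.isSection
  cases hS with
  | cons tail _ h2 h3 h4 =>
    obtain rfl := hS'.unique tail
    refine ⟨S', fun h => ?_, fun a => ?_, fun g hg => ?_⟩
    · exact h2 _ ((h3 _).2 ⟨1, 1, one_mem _, by rw [kpow_one, mul_one]⟩) h
    · rw [h4]
      exact Ideal.mul_mem_right _ _ (Ideal.mem_span_singleton_self _)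
    · refine (h' _ _ (B.isCoord_coord 1).1 (B.isCoord_coord g).1 g hg ?_).2
      rw [← hq]
      have e1 := (B.isCoord_coord 1).2
      have e2 := (B.isCoord_coord g).2
      change 1 = listPow B.u (List.finRange m) (B.coord 1) at e1
      rw [← e1, one_mul]
      exact e2

end

/-- A pseudo-basis of length `m` of a `K`-group, for any `K`, with quotient functions and with
values for the variables. -/
structure Env (m : ℕ) (V : Type) where
  K : Type u
  [commRing : CommRing K]
  [binomialRing : BinomialRing K]
  G : Type v
  [group : Group G]
  [kGroup : KGroup K G]
  B : PseudoBasis K G m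
  r : Fin m → K → K
  isQuotient : B.IsQuotient r
  x : V → K

namespace Env

attribute [instance] Env.commRing Env.binomialRing Env.group Env.kGroup

variable (m : ℕ) (V : Type)

/-- Powers in the product of all groups, with exponents in the product of all rings. -/
noncomputable def power :
    HallPower (∀ ω : Env.{u, v} m V, ω.G) (∀ ω : Env.{u, v} m V, ω.K) m where
  pw g a ω := kpow (g ω) (a ω)
  ch a i ω := Ring.choose (a ω) i
  ch_one _ := funext fun _ => Ring.choose_one_right _
  pw_one _ := funext fun _ => kpow_one _
  pw_add _ _ _ := funext fun _ => kpow_add _ _ _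
  pw_mul _ _ _ := funext fun _ => kpow_mul _ _ _
  pw_conj _ _ _ := funext fun _ => kpow_conj _ _ _
  pw_hall l a := funext fun ω => by
    -- The length of the law must not depend on `ω`; the common length `m` provides this.
    have hN : Group.nilpotencyClass ω.G ≤ m + 1 := by
      have := ω.B.chain.nilpotencyClass_le
      rw [List.length_finRange] at this
      omega
    have h := (hallPower ω.K ω.G m hN).pw_hall (l.map fun g => g ω) (a ω)
    have h1 := map_list_prod (Pi.evalMonoidHom (fun ω : Env.{u, v} m V => ω.G) ω)
    have h2 := map_hallWord (Pi.evalMonoidHom (fun ω : Env.{u, v} m V => ω.G) ω) l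
    simp only [Pi.evalMonoidHom_apply] at h1 h2
    rw [h1, h1, List.map_map, List.map_map]
    rw [List.map_map] at h
    refine h.trans ?_
    congr 1
    refine List.map_congr_left fun i _ => ?_
    simp only [Function.comp_apply, Pi.evalMonoidHom_apply, h2]
    rfl

/-- The functions that are given by terms. -/
noncomputable def termRing : Subring (∀ ω : Env.{u, v} m V, ω.K) where
  carrier := {f | ∃ s : Term m V, ∀ ω, f ω = s.eval ω.B ω.r ω.x}
  mul_mem' := by
    rintro f g ⟨s, hs⟩ ⟨t, ht⟩
    exact ⟨.mul s t, fun ω => by rw [Pi.mul_apply, hs, ht]; rfl⟩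
  one_mem' := ⟨.nat 1, fun ω => Nat.cast_one.symm⟩
  add_mem' := by
    rintro f g ⟨s, hs⟩ ⟨t, ht⟩
    exact ⟨.add s t, fun ω => by rw [Pi.add_apply, hs, ht]; rfl⟩
  zero_mem' := ⟨.nat 0, fun ω => Nat.cast_zero.symm⟩
  neg_mem' := by
    rintro f ⟨s, hs⟩
    exact ⟨.neg s, fun ω => by rw [Pi.neg_apply, hs]; rfl⟩

variable {m V}

/-- The family of the elements `u_j`. -/
def gen (j : Fin m) (ω : Env.{u, v} m V) : ω.G := ω.B.u j

theorem ch_mem : ∀ a ∈ termRing m V, ∀ i, (power.{u, v} m V).ch a i ∈ termRing m V := by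
  rintro a ⟨s, hs⟩ i
  exact ⟨.binom i s, fun ω => congrArg (Ring.choose · i) (hs ω)⟩

/-- The core of the proof. Closure and normalisation must be carried along with the coordinates,
since each adjunction of a `u_j` relies on them for the tail. -/
theorem exists_subgroup (p q : List (Fin m)) (hq : List.finRange m = p ++ q) :
    ∃ L : Subgroup (∀ ω : Env.{u, v} m V, ω.G),
      (power m V).Closed (termRing m V) L ∧
      (∀ s, (power m V).Normalises (termRing m V) (gen s) L) ∧
      (∀ α : Fin m → ∀ ω : Env.{u, v} m V, ω.K, (∀ j, α j ∈ termRing m V) →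
        (fun ω => listPow ω.B.u q fun j => α j ω) ∈ L) ∧
      ∀ g ∈ L, ∃ β : Fin m → ∀ ω : Env.{u, v} m V, ω.K, (∀ j, β j ∈ termRing m V) ∧
        (∀ j ω, β j ω ∈ Set.range (ω.B.d j)) ∧
        ∀ ω, g ω = listPow ω.B.u q fun j => β j ω := by
  induction q generalizing p with
  | nil =>
    refine ⟨⊥, ?_, ?_, ?_, ?_⟩
    · intro a _ g hg
      rw [Subgroup.mem_bot.1 hg, HallPower.one_pw]
      exact one_mem _
    · intro s b _ h hh
      rw [Subgroup.mem_bot.1 hh, mul_one, inv_mul_cancel]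
      exact one_mem _
    · exact fun α _ => one_mem _
    · intro g hg
      refine ⟨fun j ω => ω.B.d j 0, fun j => ⟨.sect j (.nat 0), fun ω => ?_⟩,
        fun j ω => ⟨0, rfl⟩, fun ω => ?_⟩
      · simp [Term.eval]
      · rw [Subgroup.mem_bot.1 hg]; rfl
  | cons j q ih =>
    obtain ⟨L, hL, hN, hmem, hcoord⟩ := ih (p ++ [j]) (by rw [hq]; simp)
    choose S hS1 hS2 hS3 using fun ω : Env.{u, v} m V => ω.B.listPow_coord hq
    have hjq : j ∉ q := by
      have hnd := List.nodup_finRange m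
      rw [hq] at hnd
      exact (List.nodup_cons.1 (List.nodup_append.1 hnd).2.1).1
    -- A section may represent `0` by a nonzero element, so the coordinates of `1` need not vanish.
    -- They are structural constants because `[u_j, u_j] = 1`.
    have hone : ∀ k, (fun ω : Env.{u, v} m V => ω.B.coord 1 k) ∈ termRing m V := fun k => by
      refine ⟨.comm j j k, fun ω => ?_⟩
      simp only [Term.eval, PseudoBasis.commConst]
      congr 2
      group
    -- On `S ω` the coordinates before `q` agree with those of `1` and cancel, so `g` is a quotient
    -- of two products over `q` with exponents given by terms.
    have hrec : ∀ g : ∀ ω : Env.{u, v} m V, ω.G, (∀ ω, g ω ∈ S ω) →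
        (∀ k, (fun ω => ω.B.coord (g ω) k) ∈ termRing m V) → g ∈ L := by
      intro g hg hk
      have h1 := hmem _ hone
      have h2 := hmem _ hk
      have h3 : g = (fun ω : Env.{u, v} m V => listPow ω.B.u q fun k => ω.B.coord 1 k)⁻¹ *
          fun ω => listPow ω.B.u q fun k => ω.B.coord (g ω) k := by
        funext ω
        rw [Pi.mul_apply, Pi.inv_apply, eq_inv_mul_iff_mul_eq]
        exact hS3 ω _ (hg ω)
      rw [h3]
      exact mul_mem (inv_mem h1) h2
    have hcomm : ∀ s, (gen s)⁻¹ * (gen j)⁻¹ * gen s * gen j ∈ L := fun s =>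
      hrec _ (fun ω => comm_mem_swap (hS1 ω (ω.B.u s))) fun k => ⟨.comm s j k, fun ω => rfl⟩
    have hpow : (fun ω : Env.{u, v} m V => kpow (ω.B.u j) (ω.B.e j)) ∈ L :=
      hrec _ (fun ω => by simpa using hS2 ω 1) fun k => ⟨.power j k, fun ω => rfl⟩
    refine ⟨(power m V).adjoin _ (gen j) L (hN j), HallPower.closed_adjoin _ hL ch_mem,
      fun s => (hN s).adjoin (hN j) hL ch_mem (hcomm s), fun α hα => ?_, ?_⟩
    · refine ⟨α j, hα j, _, hmem α hα, ?_⟩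
      funext ω
      exact listPow_cons _ _ _ _
    · rintro _ ⟨a, ⟨s, hs⟩, h, hh, rfl⟩
      -- Splitting `a = e_j r_j(a) + d_j(a)` leaves `d_j(a)` as the coordinate; the power `(u_j ^
      -- e_j) ^ r_j(a)` is absorbed into `L`.
      have hr : (fun ω : Env.{u, v} m V => ω.r j (a ω)) ∈ termRing m V :=
        ⟨.quot j s, fun ω => congrArg (ω.r j) (hs ω)⟩
      obtain ⟨β, hβ1, hβ2, hβ3⟩ := hcoord _ (mul_mem (hL _ hr _ hpow) hh)
      refine ⟨Function.update β j fun ω => ω.B.d j (a ω), fun i => ?_, fun i ω => ?_,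
        fun ω => ?_⟩
      · by_cases hi : i = j
        · subst hi
          rw [Function.update_self]
          exact ⟨.sect i s, fun ω => congrArg (ω.B.d i) (hs ω)⟩
        · rw [Function.update_of_ne hi]
          exact hβ1 i
      · by_cases hi : i = j
        · subst hi
          rw [Function.update_self]
          exact ⟨_, rfl⟩
        · rw [Function.update_of_ne hi]
          exact hβ2 i ω
      · rw [listPow_cons, Function.update_self, listPow_congr (β := fun i => β i ω), ← hβ3]
        · have h1 := ω.isQuotient j (a ω)
          show kpow (ω.B.u j) (a ω) * h ω = kpow (ω.B.u j) (ω.B.d j (a ω)) *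
            (kpow (kpow (ω.B.u j) (ω.B.e j)) (ω.r j (a ω)) * h ω)
          rw [← kpow_mul, ← mul_assoc, ← kpow_add, add_comm, ← h1]
        · intro i hi
          rw [Function.update_of_ne]
          rintro rfl
          exact hjq hi

theorem exists_term_of_mem {L : Subgroup (∀ ω : Env.{u, v} m V, ω.G)}
    (hL : ∀ g ∈ L, ∃ β : Fin m → ∀ ω : Env.{u, v} m V, ω.K, (∀ j, β j ∈ termRing m V) ∧
        (∀ j ω, β j ω ∈ Set.range (ω.B.d j)) ∧
        ∀ ω, g ω = listPow ω.B.u (List.finRange m) fun j => β j ω)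
    {g : ∀ ω : Env.{u, v} m V, ω.G} (hg : g ∈ L) (k : Fin m) :
    ∃ s : Term m V, ∀ ω : Env.{u, v} m V, s.eval ω.B ω.r ω.x = ω.B.coord (g ω) k := by
  obtain ⟨β, hβ1, hβ2, hβ3⟩ := hL g hg
  obtain ⟨s, hs⟩ := hβ1 k
  refine ⟨s, fun ω => ?_⟩
  rw [← hs, ω.B.coord_eq (t := fun j => β j ω) ⟨fun j => hβ2 j ω, hβ3 ω⟩]

theorem var_mem (i : V) : (fun ω : Env.{u, v} m V => ω.x i) ∈ termRing m V :=
  ⟨.var i, fun _ => rfl⟩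

end Env

/-- The variables are themselves terms, so both factors lie in the subgroup of the full tuple. Each
pseudo-basis with chosen data is one component of the product. -/
theorem exists_mulTerm (m : ℕ) (k : Fin m) :
    ∃ s : Term m (Fin m ⊕ Fin m), ∀ (K : Type u) [CommRing K] [BinomialRing K]
      (G : Type v) [Group G] [KGroup K G] (B : PseudoBasis K G m),
      s.Computes B fun x => B.coord (vecPow B.u (fun i => x (Sum.inl i)) *
        vecPow B.u (fun i => x (Sum.inr i))) k := by
  obtain ⟨L, -, -, hmem, hL⟩ := Env.exists_subgroup.{u, v} (V := Fin m ⊕ Fin m) [] _ rfl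
  obtain ⟨s, hs⟩ := Env.exists_term_of_mem hL
    (mul_mem (hmem _ fun i => Env.var_mem (Sum.inl i)) (hmem _ fun i => Env.var_mem (Sum.inr i))) k
  exact ⟨s, fun K _ _ G _ _ B r hr x => hs ⟨K, G, B, r, hr, x⟩⟩

theorem exists_powTerm (m : ℕ) (k : Fin m) :
    ∃ s : Term m (Fin m ⊕ Unit), ∀ (K : Type u) [CommRing K] [BinomialRing K]
      (G : Type v) [Group G] [KGroup K G] (B : PseudoBasis K G m),
      s.Computes B fun x => B.coord (kpow (vecPow B.u (fun i => x (Sum.inl i)))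
        (x (Sum.inr ()))) k := by
  obtain ⟨L, hcl, -, hmem, hL⟩ := Env.exists_subgroup.{u, v} (V := Fin m ⊕ Unit) [] _ rfl
  obtain ⟨s, hs⟩ := Env.exists_term_of_mem hL
    (hcl _ (Env.var_mem (Sum.inr ())) _ (hmem _ fun i => Env.var_mem (Sum.inl i))) k
  exact ⟨s, fun K _ _ G _ _ B r hr x => hs ⟨K, G, B, r, hr, x⟩⟩

end KGroup

/-! ### Isomorphisms and structural constants -/

namespace KGroup

section

variable {K : Type*} [CommRing K] [BinomialRing K] {G : Type*} [Group G] [KGroup K G]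

theorem map_vecPow {H : Type*} [Group H] [KGroup K H] (f : G ≃* H)
    (hf : ∀ (g : G) (a : K), f (kpow g a) = kpow (f g) a) {m : ℕ} (u : Fin m → G)
    (α : Fin m → K) : f (vecPow u α) = vecPow (f ∘ u) α := by
  rw [vecPow, map_list_prod, List.map_map, vecPow]
  congr 1
  exact List.map_congr_left fun j _ => hf _ _

theorem map_blockPow {H : Type*} [Group H] [KGroup K H] (f : G ≃* H)
    (hf : ∀ (g : G) (a : K), f (kpow g a) = kpow (f g) a) {m : ℕ} (u : Fin m → G)
    (p : Fin m → Prop) [DecidablePred p] (α : Fin m → K) :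
    f (blockPow u p α) = blockPow (f ∘ u) p α := by
  rw [blockPow, map_list_prod, List.map_map, blockPow]
  congr 1
  exact List.map_congr_left fun j _ => hf _ _

theorem IsPseudoBasis.map {H : Type*} [Group H] [KGroup K H] (f : G ≃* H)
    (hf : ∀ (g : G) (a : K), f (kpow g a) = kpow (f g) a) {m : ℕ} {u : Fin m → G}
    {e : Fin m → K} (h : IsPseudoBasis u e) : IsPseudoBasis (f ∘ u) e := by
  have hf' : ∀ (g : H) (a : K), f.symm (kpow g a) = kpow (f.symm g) a := fun g a => by
    rw [f.symm_apply_eq, hf, f.apply_symm_apply]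
  obtain ⟨c, S, lev, h0, hc, hle, hK, hcomm, hmono, hbase⟩ := h
  refine ⟨c, fun i => (S i).comap f.symm.toMonoidHom, lev, ?_, ?_, ?_, ?_, ?_, hmono, ?_⟩
  · simp [h0]
  · simp only [hc]
    ext g
    simp
  · exact fun i hi => Subgroup.comap_mono (hle i hi)
  · intro i hi a g hg
    have := hK i hi a _ hg
    change f.symm (kpow g a) ∈ S i
    rw [hf']
    exact this
  · intro i hi g hg h
    have := hcomm i hi _ hg (f.symm h)
    change f.symm _ ∈ S (i + 1)
    simpa using this
  · intro i hi
    have hb := hbase i hi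
    refine ⟨fun j hj => ?_, fun g hg => ?_, fun α hα j hj => ?_, fun j hj a => ?_⟩
    · change f.symm (f (u j)) ∈ S i
      rw [f.symm_apply_apply]
      exact hb.mem j hj
    · obtain ⟨α, hα⟩ := hb.generates _ hg
      refine ⟨α, ?_⟩
      change f.symm _ ∈ S (i + 1)
      rw [← map_blockPow f hf, map_mul, map_inv, f.symm_apply_apply]
      exact hα
    · change f.symm _ ∈ S (i + 1)
      rw [← map_blockPow f hf] at hα
      change f.symm (f _) ∈ S (i + 1) at hα
      rw [f.symm_apply_apply] at hα
      rw [hf', Function.comp_apply, f.symm_apply_apply]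
      exact hb.direct α hα j hj
    · rw [← hb.period j hj]
      change f.symm _ ∈ S (i + 1) ↔ _
      rw [hf', Function.comp_apply, f.symm_apply_apply]

namespace PseudoBasis

variable {m : ℕ} (B : PseudoBasis K G m)

/-- The image of a pseudo-basis under an isomorphism. -/
def map {H : Type*} [Group H] [KGroup K H] (f : G ≃* H)
    (hf : ∀ (g : G) (a : K), f (kpow g a) = kpow (f g) a) : PseudoBasis K H m where
  u := f ∘ B.u
  e := B.e
  d := B.d
  isPseudoBasis := B.isPseudoBasis.map f hf
  d_mem := B.d_mem
  d_const := B.d_const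

theorem coord_map {H : Type*} [Group H] [KGroup K H] (f : G ≃* H)
    (hf : ∀ (g : G) (a : K), f (kpow g a) = kpow (f g) a) (g : G) :
    (B.map f hf).coord (f g) = B.coord g := by
  refine coord_eq _ ⟨(B.isCoord_coord g).1, ?_⟩
  conv_lhs => rw [(B.isCoord_coord g).2]
  exact map_vecPow f hf _ _

theorem commConst_map {H : Type*} [Group H] [KGroup K H] (f : G ≃* H)
    (hf : ∀ (g : G) (a : K), f (kpow g a) = kpow (f g) a) (i j k : Fin m) :
    (B.map f hf).commConst i j k = B.commConst i j k := by
  rw [commConst, commConst, ← B.coord_map f hf]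
  simp [map]

theorem powConst_map {H : Type*} [Group H] [KGroup K H] (f : G ≃* H)
    (hf : ∀ (g : G) (a : K), f (kpow g a) = kpow (f g) a) (i k : Fin m) :
    (B.map f hf).powConst i k = B.powConst i k := by
  rw [powConst, powConst, ← B.coord_map f hf, hf]
  rfl

theorem coord_vecPow {t : Fin m → K} (ht : ∀ i, t i ∈ Set.range (B.d i)) :
    B.coord (vecPow B.u t) = t :=
  B.coord_eq ⟨ht, rfl⟩

theorem vecPow_coord (g : G) : vecPow B.u (B.coord g) = g := (B.isCoord_coord g).2.symm

theorem exists_isQuotient : ∃ r, B.IsQuotient r := by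
  have h : ∀ i x, ∃ y, x = B.e i * y + B.d i x := fun i x => by
    obtain ⟨y, hy⟩ := Ideal.mem_span_singleton.1 (B.d_mem i x)
    exact ⟨-y, by rw [mul_neg, ← hy]; ring⟩
  choose r hr using h
  exact ⟨r, hr⟩

end PseudoBasis

theorem Term.eval_congr {H : Type*} [Group H] [KGroup K H] {m : ℕ} {B : PseudoBasis K G m}
    {C : PseudoBasis K H m} (hd : B.d = C.d)
    (hcomm : ∀ i j k, B.commConst i j k = C.commConst i j k)
    (hpow : ∀ i k, B.powConst i k = C.powConst i k) {V : Type} (r : Fin m → K → K) (x : V → K)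
    (s : Term m V) : s.eval B r x = s.eval C r x := by
  induction s <;> simp_all [Term.eval]

end

section

variable {K : Type u} [CommRing K] [BinomialRing K] {G H : Type v} [Group G] [KGroup K G]
  [Group H] [KGroup K H] {m : ℕ} {B : PseudoBasis K G m} {C : PseudoBasis K H m}

/-- The isomorphism keeps coordinates fixed: the same terms, with the same values of all symbols,
compute products and powers in both groups. -/
theorem kIsomorphic_of_section_eq (he : B.e = C.e) (hd : B.d = C.d)
    (hcomm : ∀ i j k, B.commConst i j k = C.commConst i j k)
    (hpow : ∀ i k, B.powConst i k = C.powConst i k) : KIsomorphic K G H := by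
  obtain ⟨r, hr⟩ := B.exists_isQuotient
  have hr' : C.IsQuotient r := by
    rw [PseudoBasis.IsQuotient, ← he, ← hd]
    exact hr
  choose M hM using exists_mulTerm.{u, v} m
  choose D hD using exists_powTerm.{u, v} m
  have hmul : ∀ s t : Fin m → K, B.coord (vecPow B.u s * vecPow B.u t) =
      C.coord (vecPow C.u s * vecPow C.u t) := fun s t => funext fun k => by
    have h1 := hM k K G B r hr (Sum.elim s t)
    have h2 := hM k K H C r hr' (Sum.elim s t)
    rw [Term.eval_congr hd hcomm hpow, h2] at h1
    exact h1.symm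
  have hkpow : ∀ (s : Fin m → K) (a : K), B.coord (kpow (vecPow B.u s) a) =
      C.coord (kpow (vecPow C.u s) a) := fun s a => funext fun k => by
    have h1 := hD k K G B r hr (Sum.elim s fun _ => a)
    have h2 := hD k K H C r hr' (Sum.elim s fun _ => a)
    rw [Term.eval_congr hd hcomm hpow, h2] at h1
    exact h1.symm
  refine ⟨⟨⟨fun g => vecPow C.u (B.coord g), fun h => vecPow B.u (C.coord h), fun g => ?_,
    fun h => ?_⟩, fun g h => ?_⟩, fun g a => ?_⟩
  · dsimp only
    rw [C.coord_vecPow (hd ▸ (B.isCoord_coord g).1), B.vecPow_coord]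
  · dsimp only
    rw [B.coord_vecPow (hd ▸ (C.isCoord_coord h).1), C.vecPow_coord]
  · have := hmul (B.coord g) (B.coord h)
    rw [B.vecPow_coord, B.vecPow_coord] at this
    dsimp only
    rw [this, C.vecPow_coord]
  · have := hkpow (B.coord g) a
    rw [B.vecPow_coord] at this
    show vecPow C.u (B.coord (kpow g a)) = kpow (vecPow C.u (B.coord g)) a
    rw [this, C.vecPow_coord]

/-- Give the second pseudo-basis the section of the first. Its structural constants do not change:
being equal to those of the first, they are already values of that section. -/
theorem kIsomorphic_of_constants_eq (he : B.e = C.e)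
    (hcomm : ∀ i j k, B.commConst i j k = C.commConst i j k)
    (hpow : ∀ i k, B.powConst i k = C.powConst i k) : KIsomorphic K G H := by
  let C' : PseudoBasis K H m := ⟨C.u, C.e, B.d, C.isPseudoBasis, he ▸ B.d_mem, he ▸ B.d_const⟩
  have hco : ∀ h : H, (∀ k, C.coord h k ∈ Set.range (B.d k)) → C'.coord h = C.coord h :=
    fun h hk => C'.coord_eq ⟨hk, (C.isCoord_coord h).2⟩
  refine kIsomorphic_of_section_eq (B := B) (C := C') he rfl (fun i j k => ?_) fun i k => ?_
  · rw [hcomm]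
    refine (congrFun (hco _ fun k => ?_) k).symm
    have := hcomm i j k
    rw [PseudoBasis.commConst, PseudoBasis.commConst] at this
    rw [← this]
    exact (B.isCoord_coord _).1 k
  · rw [hpow]
    refine (congrFun (hco _ fun k => ?_) k).symm
    have := hpow i k
    rw [PseudoBasis.powConst, PseudoBasis.powConst] at this
    rw [← this]
    exact (B.isCoord_coord _).1 k

end

section

variable {K : Type*} [CommRing K] [BinomialRing K] {G : Type*} [Group G] [KGroup K G]

/-- Transport of the structure of a `K`-group along an isomorphism of groups. -/
@[reducible]
def ofMulEquiv {H : Type*} [Group H] (f : H ≃* G) : KGroup K H where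
  nilpotent := by
    have : Group.IsNilpotent G := KGroup.nilpotent K
    exact Group.nilpotent_of_mulEquiv f.symm
  kpow x a := f.symm (kpow (f x) a)
  kpow_one x := by rw [kpow_one, f.symm_apply_apply]
  kpow_add x a b := by rw [kpow_add, map_mul]
  kpow_mul x a b := by rw [kpow_mul, f.apply_symm_apply]
  kpow_conj x y a := by
    apply f.injective
    simp [← kpow_conj]
  kpow_hall l a := by
    have : Group.IsNilpotent G := KGroup.nilpotent K
    have hcl : Group.nilpotencyClass H = Group.nilpotencyClass G :=
      le_antisymm (Group.nilpotencyClass_le_of_surjective f.symm.toMonoidHom f.symm.surjective)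
        (have := Group.nilpotent_of_mulEquiv f.symm
        Group.nilpotencyClass_le_of_surjective f.toMonoidHom f.surjective)
    have h := congrArg f.symm (kpow_hall (l.map f) a)
    have h2 := map_hallWord (f : H →* G) l
    simp only [MonoidHom.coe_coe] at h2
    rw [map_list_prod, map_list_prod, List.map_map, List.map_map, List.map_map] at h
    rw [hcl]
    simp only [h2]
    exact h

end

end KGroup

/-! ### Existence of pseudo-bases and the corollary -/

namespace KGroup

section

variable {K : Type*} [CommRing K] [BinomialRing K] {G : Type*} [Group G] [KGroup K G]

/-- The exponents that send `y` into `S` form an ideal, which is principal. -/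
theorem NormalK.exists_period [IsPrincipalIdealRing K] {S : Subgroup G} (hS : NormalK K S)
    (y : G) : ∃ e : K, ∀ a : K, kpow y a ∈ S ↔ a ∈ Ideal.span {e} := by
  let I : Ideal K :=
    { carrier := {a | kpow y a ∈ S}
      add_mem' := fun {a b} ha hb => by
        rw [Set.mem_ofPred_eq, kpow_add]
        exact mul_mem ha hb
      zero_mem' := by
        rw [Set.mem_ofPred_eq, kpow_zero]
        exact one_mem S
      smul_mem' := fun c a ha => by
        rw [Set.mem_ofPred_eq, smul_eq_mul, mul_comm, kpow_mul]
        exact hS.kpow_mem _ _ ha }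
  refine ⟨Submodule.IsPrincipal.generator I, fun a => ?_⟩
  rw [Ideal.span_singleton_generator]
  rfl

/-- The elements `g` with `[g, y] ∈ S`. -/
def NormalK.commSubgroup {S : Subgroup G} (hS : NormalK K S) (y : G) : Subgroup G where
  carrier := {g | g⁻¹ * y⁻¹ * g * y ∈ S}
  mul_mem' := fun {g h} hg hh => by
    have := mul_mem (hS.conj_mem hg h) hh
    rw [Set.mem_ofPred_eq]
    convert this using 1
    group
  one_mem' := by simp
  inv_mem' := fun {g} hg => by
    have := hS.conj_mem (inv_mem hg) g⁻¹
    rw [Set.mem_ofPred_eq]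
    convert this using 1
    group

theorem Chain.extend_list [IsPrincipalIdealRing K] {S : Subgroup G} {q : List (G × K)}
    (hc : Chain Prod.fst Prod.snd S q) (l : List G)
    (hl : ∀ y ∈ l, ∀ h : G, y⁻¹ * h⁻¹ * y * h ∈ S) :
    ∃ (T : Subgroup G) (q' : List (G × K)), Chain Prod.fst Prod.snd T q' ∧ S ≤ T ∧
      ∀ y ∈ l, y ∈ T := by
  induction l with
  | nil => exact ⟨S, q, hc, le_rfl, by simp⟩
  | cons y l ih =>
    obtain ⟨T, q', hT, hST, hlT⟩ := ih fun z hz => hl z (List.mem_cons_of_mem _ hz)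
    obtain ⟨e, he⟩ := hT.normalK.exists_period y
    obtain ⟨T', hT', hm⟩ := hT.extend (y, e) (fun h => hST (hl y List.mem_cons_self h)) he
    have hTT : T ≤ T' := fun g hg => (hm g).2 ⟨0, g, hg, by rw [kpow_zero, one_mul]⟩
    refine ⟨T', _, hT', hST.trans hTT, fun z hz => ?_⟩
    rcases List.mem_cons.1 hz with rfl | hz
    · exact (hm _).2 ⟨1, 1, one_mem _, by rw [kpow_one, mul_one]⟩
    · exact hTT (hlT z hz)

/-- The iterated commutators of weight `k + 1` of the entries of a list. -/
def iterComm (X : List G) : ℕ → List G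
  | 0 => X
  | k + 1 => (iterComm X k).flatMap fun y => X.map fun x => y⁻¹ * x⁻¹ * y * x

theorem iterComm_mem (X : List G) (k : ℕ) :
    ∀ y ∈ iterComm X k, y ∈ Subgroup.lowerCentralSeries (⊤ : Subgroup G) k := by
  induction k with
  | zero => simp
  | succ k ih =>
    intro z hz
    obtain ⟨y, hy, hz⟩ := List.mem_flatMap.1 hz
    obtain ⟨x, -, rfl⟩ := List.mem_map.1 hz
    have := Subgroup.commutator_mem_commutator (inv_mem (ih y hy))
      (Subgroup.mem_top (x⁻¹ : G))
    rw [Subgroup.lowerCentralSeries_succ]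
    simpa [commutatorElement_def] using this

/-- Once the commutators of weight `k + 1` lie in `T`, those of weight `k` commute with the
generators modulo `T`, hence with all of `G`, and can be adjoined as central elements. -/
theorem FinGen.exists_chain [IsPrincipalIdealRing K] (hG : FinGen K G) :
    ∃ q : List (G × K), Chain Prod.fst Prod.snd (⊤ : Subgroup G) q := by
  obtain ⟨X, hX⟩ := hG
  have hnil : Group.IsNilpotent G := KGroup.nilpotent K
  have key : ∀ k ≤ Group.nilpotencyClass G, ∃ (T : Subgroup G) (q : List (G × K)),
      Chain Prod.fst Prod.snd T q ∧
        ∀ y ∈ iterComm X.toList (Group.nilpotencyClass G - k), y ∈ T := by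
    intro k
    induction k with
    | zero =>
      refine fun _ => ⟨⊥, [], .nil, fun y hy => ?_⟩
      have h1 := iterComm_mem _ _ y hy
      rwa [Subgroup.lowerCentralSeries_eq_bot_iff_nilpotencyClass_le.2 (by simp)] at h1
    | succ k ih =>
      intro hk
      obtain ⟨T, q, hT, hm⟩ := ih (by omega)
      rw [show Group.nilpotencyClass G - k = Group.nilpotencyClass G - (k + 1) + 1 by omega] at hm
      have hn := hT.normalK
      obtain ⟨T', q', hT', -, hm'⟩ := hT.extend_list
        (iterComm X.toList (Group.nilpotencyClass G - (k + 1))) fun y hy h => by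
          -- The elements commuting with `y` modulo `T` form a `K`-subgroup containing the
          -- generators.
          have htop := hX (hn.commSubgroup y) (fun a g hg => hn.comm_kpow_mem hg a) fun x hx =>
            comm_mem_swap (hm _ (List.mem_flatMap.2 ⟨y, hy, List.mem_map.2
              ⟨x, Finset.mem_toList.2 hx, rfl⟩⟩))
          have hh : h ∈ hn.commSubgroup y := htop ▸ Subgroup.mem_top h
          exact comm_mem_swap hh
      exact ⟨T', q', hT', hm'⟩
  obtain ⟨T, q, hT, hm⟩ := key _ le_rfl
  rw [Nat.sub_self] at hm
  obtain rfl := hX T hT.normalK.kpow_mem fun x hx => hm x (Finset.mem_toList.2 hx)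
  exact ⟨q, hT⟩

theorem Chain.exists_series {ι : Type*} {u : ι → G} {e : ι → K} {S : Subgroup G} {q : List ι}
    (hc : Chain u e S q) :
    ∃ T : ℕ → Subgroup G, T 0 = S ∧ T q.length = ⊥ ∧ ∀ i (hi : i < q.length),
      IsKSubgroup K (T i) ∧ (∀ g ∈ T i, ∀ h : G, g⁻¹ * h⁻¹ * g * h ∈ T (i + 1)) ∧
      (∀ g, g ∈ T i ↔ ∃ a : K, ∃ h ∈ T (i + 1), g = kpow (u q[i]) a * h) ∧
      ∀ a : K, kpow (u q[i]) a ∈ T (i + 1) ↔ a ∈ Ideal.span {e q[i]} := by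
  induction hc with
  | nil => exact ⟨fun _ => ⊥, rfl, rfl, fun i hi => absurd hi (by simp)⟩
  | @cons S S' j q tail h1 h2 h3 h4 ih =>
    obtain ⟨T, rfl, hb, hT⟩ := ih
    refine ⟨fun i => Nat.casesOn i S T, rfl, hb, fun i hi => ?_⟩
    cases i with
    | zero => exact ⟨h1, h2, h3, h4⟩
    | succ i => exact hT i (by simpa using hi)

theorem blockPow_eq {m : ℕ} (u : Fin m → G) (i : Fin m) (α : Fin m → K) :
    blockPow u (fun j => (j : ℕ) = i) α = kpow (u i) (α i) := by
  have h : (List.finRange m).filter (fun j : Fin m => decide ((j : ℕ) = (i : ℕ))) = [i] := by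
    have h1 : (fun j : Fin m => decide ((j : ℕ) = i)) = fun j => j == i := by
      funext j
      rw [Bool.eq_iff_iff]
      simp [Fin.ext_iff]
    rw [h1, List.filter_beq, List.count_eq_one_of_mem (List.nodup_finRange m) (List.mem_finRange i)]
    rfl
  rw [blockPow, h]
  simp

/-- Every block has a single entry, so directness is immediate. -/
theorem Chain.isPseudoBasis {ι : Type*} {u : ι → G} {e : ι → K} {q : List ι}
    (hc : Chain u e ⊤ q) :
    IsPseudoBasis (fun i : Fin q.length => u q[i]) (fun i : Fin q.length => e q[i]) := by
  obtain ⟨T, h0, hb, hT⟩ := hc.exists_series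
  have hle : ∀ i < q.length, T (i + 1) ≤ T i := fun i hi g hg =>
    ((hT i hi).2.2.1 g).2 ⟨0, g, hg, by rw [kpow_zero, one_mul]⟩
  refine ⟨q.length, T, id, h0, hb, hle, fun i hi => ?_, fun i hi => (hT i hi).2.1, monotone_id,
    fun i hi => ?_⟩
  · rcases hi.lt_or_eq with hi | rfl
    · exact (hT i hi).1
    · rw [hb]
      exact (Chain.nil (u := u) (e := e)).normalK.kpow_mem
  · obtain ⟨-, -, h3, h4⟩ := hT i hi
    have hbl : ∀ α : Fin q.length → K, blockPow (fun i : Fin q.length => u q[i])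
        (fun j => ((id j : Fin q.length) : ℕ) = i) α = kpow (u q[i]) (α ⟨i, hi⟩) :=
      blockPow_eq (fun i : Fin q.length => u q[i]) ⟨i, hi⟩
    refine ⟨fun j hj => ?_, fun g hg => ?_, fun α hα j hj => ?_, fun j hj => ?_⟩
    · subst hj
      exact (h3 _).2 ⟨1, 1, one_mem _, by rw [kpow_one, mul_one]; rfl⟩
    · obtain ⟨a, h, hh, rfl⟩ := (h3 g).1 hg
      exact ⟨fun _ => a, by rwa [hbl, inv_mul_cancel_left]⟩
    · rw [hbl] at hα
      subst hj
      exact hα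
    · subst hj
      exact h4

theorem FinGen.exists_pseudoBasis [IsPrincipalIdealRing K] (hG : FinGen K G) :
    ∃ m, Nonempty (PseudoBasis K G m) := by
  obtain ⟨q, hq⟩ := hG.exists_chain
  refine ⟨q.length, ⟨⟨_, _, fun i x => (Ideal.Quotient.mk (Ideal.span {q[i].2}) x).out,
    hq.isPseudoBasis, fun i x => ?_, fun i x y h => ?_⟩⟩⟩
  · rw [← Ideal.Quotient.eq]
    exact Quotient.out_eq _
  · exact congrArg Quotient.out (Ideal.Quotient.eq.2 h)

end

theorem kIsomorphic_iff {K : Type u} [CommRing K] [IsPrincipalIdealRing K] [BinomialRing K]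
    {G : Type v} [Group G] [KGroup K G] {H : Type w} [Group H] [KGroup K H] (hG : FinGen K G) :
    KIsomorphic K G H ↔ ∃ (m : ℕ) (B : PseudoBasis K G m) (C : PseudoBasis K H m),
      B.e = C.e ∧ (∀ i j k, B.commConst i j k = C.commConst i j k) ∧
        ∀ i k, B.powConst i k = C.powConst i k := by
  constructor
  · rintro ⟨f, hf⟩
    obtain ⟨m, ⟨B⟩⟩ := hG.exists_pseudoBasis
    exact ⟨m, B, B.map f hf, rfl, fun i j k => (B.commConst_map f hf i j k).symm,
      fun i k => (B.powConst_map f hf i k).symm⟩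
  · rintro ⟨m, B, C, he, hcomm, hpow⟩
    -- The terms are obtained for groups in one fixed universe, so both groups are lifted to a
    -- common one before they are compared.
    let fG : ULift.{w} G ≃* G := MulEquiv.ulift
    let fH : ULift.{v} H ≃* H := MulEquiv.ulift
    let : KGroup K (ULift.{w} G) := ofMulEquiv fG
    let : KGroup K (ULift.{v} H) := ofMulEquiv fH
    have hG' : ∀ (g : G) (a : K), fG.symm (kpow g a) = kpow (fG.symm g) a := fun _ _ => rfl
    have hH' : ∀ (g : H) (a : K), fH.symm (kpow g a) = kpow (fH.symm g) a := fun _ _ => rfl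
    obtain ⟨f, hf⟩ := kIsomorphic_of_constants_eq (B := B.map fG.symm hG')
      (C := C.map fH.symm hH') he
      (fun i j k => by rw [B.commConst_map, C.commConst_map, hcomm])
      (fun i k => by rw [B.powConst_map, C.powConst_map, hpow])
    refine ⟨fG.symm.trans (f.trans fH), fun g a => ?_⟩
    show fH (f (fG.symm (kpow g a))) = kpow (fH (f (fG.symm g))) a
    rw [hG', hf]
    rfl

end KGroup

theorem mainTheorem11 :
    (∀ m : ℕ,
      ∃ (M : Fin m → KGroup.Term m (Fin m ⊕ Fin m)) (D : Fin m → KGroup.Term m (Fin m ⊕ Unit)),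
        ∀ (K : Type u) [CommRing K] [IsDomain K] [IsPrincipalIdealRing K] [BinomialRing K]
          (G : Type v) [Group G] [KGroup K G], KGroup.FinGen K G →
          ∀ B : KGroup.PseudoBasis K G m,
            (∀ g : G, ∃! t : Fin m → K, B.IsCoord g t) ∧
            (∀ k : Fin m, (M k).Computes B fun x =>
              B.coord (KGroup.vecPow B.u (fun i => x (Sum.inl i)) *
                KGroup.vecPow B.u (fun i => x (Sum.inr i))) k) ∧
            (∀ k : Fin m, (D k).Computes B fun x =>
              B.coord (KGroup.kpow (KGroup.vecPow B.u (fun i => x (Sum.inl i)))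
                (x (Sum.inr ()))) k)) ∧
    (∀ (K : Type u) [CommRing K] [IsDomain K] [IsPrincipalIdealRing K] [BinomialRing K]
      (G : Type v) [Group G] [KGroup K G] (H : Type w) [Group H] [KGroup K H],
      KGroup.FinGen K G → KGroup.FinGen K H →
      (KGroup.KIsomorphic K G H ↔
        ∃ (m : ℕ) (B : KGroup.PseudoBasis K G m) (C : KGroup.PseudoBasis K H m),
          B.e = C.e ∧ (∀ i j k, B.commConst i j k = C.commConst i j k) ∧
            ∀ i k, B.powConst i k = C.powConst i k)) := by
  refine ⟨fun m => ?_, fun K _ _ _ _ G _ _ H _ _ hG _ => KGroup.kIsomorphic_iff hG⟩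
  choose M hM using KGroup.exists_mulTerm.{u, v} m
  choose D hD using KGroup.exists_powTerm.{u, v} m
  exact ⟨M, D, fun K _ _ _ _ G _ _ _ B => ⟨B.existsUnique_isCoord, fun k => hM k K G B,
    fun k => hD k K G B⟩⟩
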